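/- Let $G$ be a connected finite graph (loops and multiple edges allowed) with edge set $E$ and a fixed reference orientation. Let $D$ be its incidence matrix with the row of one vertex removed, where the entry at (vertex $v$, edge $e$) is $1$ if $v$ is the head and $-1$ if $v$ is the tail of a non-loop edge $e$, and $0$ otherwise; let $r$ be its number of rows. Put $\operatorname{im}_{\mathbb Z}(D^T)=\operatorname{im}(D^T)\cap\mathbb Z^E$, and let $Z_D=\{\sum_{e\in E} c_e D_e : 0\le c_e\le 1\}\subseteq\mathbb R^r$ be the zonotope generated by the columns $D_e$ of $D$. Directed cycles are viewed as $\{0,\pm1\}$-vectors in $\mathbb R^E$ with respect to the reference orientation. Let $\sigma$ be an acyclic cycle signature, that is, a choice of a direction $\sigma(C)$ for each cycle $C$ of $G$ such that whenever $a_C\ge 0$ are reals with $\sum_C a_C\sigma(C)=0$, all $a_C$ are $0$. Let $S_\sigma$ be the set of $\sigma$-compatible continuous orientations, that is, of all $x\in[0,1]^E$ such that $x+\epsilon\,\sigma(C)\notin[0,1]^E$ for every $\epsilon>0$ and every cycle $C$, and let $$\widetilde{S_\sigma}=S_\sigma+\operatorname{im}_{\mathbb Z}(D^T)=\{x+y :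 x\in S_\sigma,\ y\in \operatorname{im}_{\mathbb Z}(D^T)\}.$$ Then: 1. Every vector of $\mathbb R^E$ can be written in exactly one way as $x+c$ with $x\in\widetilde{S_\sigma}$ and $c\in\ker D$, i.e. $\mathbb R^E=\widetilde{S_\sigma}\,\dot+\,\ker D$. 2. $D$ has rank $r$, and $x\mapsto Dx$ is a bijection from $\widetilde{S_\sigma}$ onto $\mathbb R^r$. 3. For each $z\in Z_D$ there is exactly one $x\in S_\sigma$ with $Dx=z$; write $\mu(z)=x$. The inverse $\mathbb R^r\to\widetilde{S_\sigma}$ of the bijection in 2, which is a section of $D$, agrees with $\mu$ on $Z_D$. 4. $D$ maps $S_\sigma$ onto $Z_D$. 5. For $x\in\widetilde{S_\sigma}$ we have $x\in\mathbb Z^E$ if and only if $Dx\in\mathbb Z^r$. -/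

import Mathlib

open scoped Graph Matrix Pointwise

namespace GraphZonotope

variable {α β : Type*}

/-- A multigraph (loops and parallel edges allowed) is connected if it has a vertex and any two of
its vertices are joined by a chain of adjacent vertices. -/
def IsConnected (G : Graph α β) : Prop :=
  V(G).Nonempty ∧ ∀ u ∈ V(G), ∀ v ∈ V(G), Relation.ReflTransGen G.Adj u v

/-- A reference orientation of `G`: every edge gets a tail and a head among its two ends. -/
structure RefOrientation (G : Graph α β) where
  tail : E(G) → V(G)
  head : E(G) → V(G)
  isLink : ∀ e : E(G), G.IsLink e (tail e) (head e)

/-- `C` is a cycle: its edges can be listed without repetition as `e i`, where `e i` joins `v i` to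
`v (i + 1)`, for distinct vertices `v 0, …, v (n - 1)` with `n ≥ 1` and cyclic indices.
The case `n = 1` is a loop, the case `n = 2` a pair of parallel edges. -/
def IsCycle (G : Graph α β) (C : Set E(G)) : Prop :=
  ∃ (n : ℕ) (_ : NeZero n) (v : Fin n → V(G)) (e : Fin n → E(G)),
    Function.Injective v ∧ Function.Injective e ∧
    (∀ i, G.IsLink (e i) (v i) (v (i + 1))) ∧ Set.range e = C

/-- `x` is the `{0, ±1}`-vector, with respect to the reference orientation `O`, of a directed cycle
with underlying cycle `C`: every edge of `C` is directed from `v i` to `v (i + 1)`, and its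
coordinate is `1` if this agrees with `O` and `-1` if it is opposite to `O`. A loop has the two
possible directions `1` and `-1`. -/
def IsDirectedCycle {G : Graph α β} (O : RefOrientation G) (C : Set E(G)) (x : E(G) → ℝ) : Prop :=
  ∃ (n : ℕ) (_ : NeZero n) (v : Fin n → V(G)) (e : Fin n → E(G)),
    Function.Injective v ∧ Function.Injective e ∧ Set.range e = C ∧
    (∀ i, (x (e i) = 1 ∧ O.tail (e i) = v i ∧ O.head (e i) = v (i + 1)) ∨
          (x (e i) = -1 ∧ O.head (e i) = v i ∧ O.tail (e i) = v (i + 1))) ∧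
    ∀ f, f ∉ C → x f = 0

/-- A cycle signature: the choice of a direction for each cycle. -/
structure CycleSignature {G : Graph α β} (O : RefOrientation G) where
  dir : {C : Set E(G) // IsCycle G C} → E(G) → ℝ
  isDirectedCycle : ∀ C, IsDirectedCycle O C.1 (dir C)

noncomputable instance instFintypeCycles (G : Graph α β) [Fintype E(G)] :
    Fintype {C : Set E(G) // IsCycle G C} :=
  Fintype.ofFinite _

variable {G : Graph α β} {O : RefOrientation G}

/-- Acyclic signature: a nonnegative combination of the chosen directed cycles vanishes only if
all its coefficients do. -/
def CycleSignature.IsAcyclic [Fintype E(G)] (σ : CycleSignature O) : Prop :=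
  ∀ a : {C : Set E(G) // IsCycle G C} → ℝ, (∀ C, 0 ≤ a C) →
    ∑ C, a C • σ.dir C = 0 → ∀ C, a C = 0

/-- The set `S_σ` of `σ`-compatible continuous orientations: the points of the cube `[0,1]^E` that
cannot be moved inside the cube along any directed cycle of `σ`. -/
def CycleSignature.compatible (σ : CycleSignature O) : Set (E(G) → ℝ) :=
  {x | x ∈ Set.Icc 0 1 ∧ ∀ C, ∀ ε : ℝ, 0 < ε → x + ε • σ.dir C ∉ Set.Icc 0 1}

/-- The incidence matrix of the reference orientation, with the row of the vertex `q` removed;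
the columns of loops are zero. -/
def incMatrix [DecidableEq α] (O : RefOrientation G) (q : V(G)) :
    Matrix {v : V(G) // v ≠ q} E(G) ℝ :=
  Matrix.of fun v e ↦
    if O.head e = O.tail e then 0
    else if O.head e = v.1 then 1
    else if O.tail e = v.1 then -1
    else 0

/-- The lattice points `ℤ^ι` of `ℝ^ι`. -/
def latticePoints (ι : Type*) : Set (ι → ℝ) :=
  {x | ∀ i, ∃ k : ℤ, x i = k}


/-- `im_ℤ(Dᵀ) = im(Dᵀ) ∩ ℤ^n`. -/
def imInt {m n : Type*} [Fintype m] (D : Matrix m n ℝ) : Set (n → ℝ) :=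
  {y | y ∈ LinearMap.range Dᵀ.mulVecLin ∧ y ∈ latticePoints n}

/-- The zonotope generated by the columns of `D`. -/
def zonotope {m n : Type*} [Fintype n] (D : Matrix m n ℝ) : Set (m → ℝ) :=
  {z | ∃ c : n → ℝ, (∀ e, 0 ≤ c e ∧ c e ≤ 1) ∧ z = ∑ e, c e • D.col e}


/-- `S̃_σ = S_σ + im_ℤ(Dᵀ)` (Minkowski sum). -/
def CycleSignature.extendedSection [DecidableEq α] [Fintype V(G)] [Fintype E(G)]
    (σ : CycleSignature O) (q : V(G)) : Set (E(G) → ℝ) :=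
  σ.compatible + imInt (incMatrix O q)

/-- The map `μ`: it sends `z` in the zonotope to the `σ`-compatible continuous orientation `x`
with `D x = z`. (The value is chosen; that there is exactly one candidate is a theorem. Values
outside the zonotope are irrelevant.) -/
noncomputable def CycleSignature.mu [DecidableEq α] [Fintype E(G)]
    (σ : CycleSignature O) (q : V(G)) : ({v : V(G) // v ≠ q} → ℝ) → (E(G) → ℝ) :=
  Function.invFunOn (fun x ↦ incMatrix O q *ᵥ x) σ.compatible

end GraphZonotope
open GraphZonotope

namespace GraphZonotope

variable {α β : Type*} {G : Graph α β} {O : RefOrientation G}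

/-! Everything rests on three facts about `D`.

Injectivity (`injOn_extendedSection`). Let `s + y` and `s' + y'` have the same image and let `k` be
their difference. Then `k ∈ ker D` is orthogonal to `y - y' ∈ im Dᵀ`. Since `y - y'` is integral and
`|s - s'| ≤ 1`, every term of this inner product is nonnegative, hence zero, so each `k e` is `0` or
`s e - s' e`. A nonzero circulation `k` would contain a directed cycle `x` with matching signs; then
`s'` can be pushed along `x` and `s` along `-x`, and `σ` chooses one of these two directions.

Fibres over the zonotope (`exists_compatible`). Acyclicity yields a linear functional positive on
all `σ(C)`; its maximizer on a fibre of the cube is compatible.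

Covering (`exists_cube_add_imInt`). Write `z = D p` and subtract from `p` the integral cut nearest
to `p - 1/2`. The Voronoi inequalities for the result `w` force `D w` into the image of the cube
(`exists_cube_mulVec_eq`).

For integrality, the non-integral edges of a compatible `s` with `D s` integral would contain a
cycle along which `s` moves both ways. -/

/-- The net inflow of `y` at the vertex `u`. -/
def RefOrientation.netFlow [DecidableEq α] [Fintype E(G)] (O : RefOrientation G) (y : E(G) → ℝ)
    (u : V(G)) : ℝ :=
  ∑ e, y e * ((if O.head e = u then 1 else 0) - (if O.tail e = u then 1 else 0))

/-! ### Incidence matrix, net flow and rank -/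

section Incidence

variable [DecidableEq α]

/-- For a loop the two indicators cancel, so loops need no separate case. -/
theorem incMatrix_apply (q : V(G)) (v : {v : V(G) // v ≠ q}) (e : E(G)) :
    incMatrix O q v e =
      (if O.head e = v.1 then (1 : ℝ) else 0) - (if O.tail e = v.1 then 1 else 0) := by
  simp only [incMatrix, Matrix.of_apply]
  split_ifs <;> simp_all

theorem incMatrix_mulVec [Fintype E(G)] (q : V(G)) (y : E(G) → ℝ) (v : {v : V(G) // v ≠ q}) :
    (incMatrix O q *ᵥ y) v = O.netFlow y v := by
  simp only [Matrix.mulVec, dotProduct, RefOrientation.netFlow, incMatrix_apply]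
  exact Finset.sum_congr rfl fun e _ ↦ mul_comm _ _

theorem sum_netFlow [Fintype V(G)] [Fintype E(G)] (y : E(G) → ℝ) : ∑ u, O.netFlow y u = 0 := by
  simp only [RefOrientation.netFlow]
  rw [Finset.sum_comm]
  refine Finset.sum_eq_zero fun e _ ↦ ?_
  rw [← Finset.mul_sum, Finset.sum_sub_distrib]
  simp

/-- Each edge leaves one vertex and enters one, so the net flows sum to zero and the removed row is
recovered from the others. -/
theorem netFlow_root [Fintype V(G)] [Fintype E(G)] (q : V(G)) (y : E(G) → ℝ) :
    O.netFlow y q = -∑ v : {v : V(G) // v ≠ q}, (incMatrix O q *ᵥ y) v := by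
  have h := sum_netFlow (O := O) y
  rw [Fintype.sum_eq_add_sum_subtype_ne _ q] at h
  simp only [incMatrix_mulVec]
  linarith

theorem netFlow_eq_zero [Fintype V(G)] [Fintype E(G)] {q : V(G)} {y : E(G) → ℝ}
    (h : incMatrix O q *ᵥ y = 0) (u : V(G)) : O.netFlow y u = 0 := by
  by_cases hu : u = q
  · subst hu
    simp [netFlow_root, h]
  · rw [← incMatrix_mulVec q y ⟨u, hu⟩, h]; rfl

/-- Extension of a potential by zero at the root. -/
def extendPotential (q : V(G)) (f : {v : V(G) // v ≠ q} → ℝ) (u : V(G)) : ℝ :=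
  if h : u = q then 0 else f ⟨u, h⟩

theorem incMatrix_transpose_mulVec [Fintype V(G)] (q : V(G)) (f : {v : V(G) // v ≠ q} → ℝ)
    (e : E(G)) : ((incMatrix O q)ᵀ *ᵥ f) e =
      extendPotential q f (O.head e) - extendPotential q f (O.tail e) := by
  have key (u : V(G)) : ∑ v : {v : V(G) // v ≠ q}, (if u = v.1 then (1 : ℝ) else 0) * f v =
      extendPotential q f u := by
    unfold extendPotential
    split_ifs with h
    · subst h
      refine Finset.sum_eq_zero fun v _ ↦ ?_
      rw [if_neg (Ne.symm v.2), zero_mul]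
    · rw [Finset.sum_eq_single ⟨u, h⟩]
      · simp
      · intro v _ hv
        rw [if_neg (fun h' ↦ hv (Subtype.ext h'.symm)), zero_mul]
      · simp
  simp only [Matrix.mulVec, dotProduct, Matrix.transpose_apply, incMatrix_apply, sub_mul,
    Finset.sum_sub_distrib, key]

/-- A potential in the kernel takes equal values at the ends of every edge; by connectedness it
equals its value at `q`, which is `0`. -/
theorem incMatrix_transpose_injective [Fintype V(G)] (hG : IsConnected G) (O : RefOrientation G)
    (q : V(G)) : Function.Injective (incMatrix O q)ᵀ.mulVecLin := by
  rw [← LinearMap.ker_eq_bot, LinearMap.ker_eq_bot']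
  intro f hf
  have hedge (e : E(G)) :
      extendPotential q f (O.head e) = extendPotential q f (O.tail e) := by
    have := congrFun hf e
    rw [Matrix.mulVecLin_apply, incMatrix_transpose_mulVec] at this
    exact sub_eq_zero.1 this
  have hreach (u v : α) (h : Relation.ReflTransGen G.Adj u v) (hu : u ∈ V(G)) :
      ∃ hv : v ∈ V(G), extendPotential q f ⟨u, hu⟩ = extendPotential q f ⟨v, hv⟩ := by
    induction h with
    | refl => exact ⟨hu, rfl⟩
    | tail _ hbc ih =>
      obtain ⟨hb, hb'⟩ := ih
      refine ⟨hbc.right_mem, hb'.trans ?_⟩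
      obtain ⟨e, he⟩ := hbc
      have hO := hedge ⟨e, he.edge_mem⟩
      rcases he.eq_and_eq_or_eq_and_eq (O.isLink ⟨e, he.edge_mem⟩) with ⟨h1, h2⟩ | ⟨h1, h2⟩
      · convert hO.symm using 2 <;> exact Subtype.ext (by assumption)
      · convert hO using 2 <;> exact Subtype.ext (by assumption)
  funext v
  obtain ⟨_, h⟩ := hreach q v.1 (hG.2 _ q.2 _ v.1.2) q.2
  have h1 : extendPotential q f ⟨q.1, q.2⟩ = 0 := by simp [extendPotential]
  have h2 : extendPotential q f v.1 = f v := by simp [extendPotential, v.2]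
  exact h2.symm.trans (h.symm.trans h1)

theorem rank_incMatrix [Fintype V(G)] [Fintype E(G)] (hG : IsConnected G) (O : RefOrientation G)
    (q : V(G)) : (incMatrix O q).rank = Fintype.card {v : V(G) // v ≠ q} := by
  rw [← Matrix.rank_transpose, Matrix.rank,
    LinearMap.finrank_range_of_inj (incMatrix_transpose_injective hG O q),
    Module.finrank_fintype_fun_eq_card]

theorem incMatrix_surjective [Fintype V(G)] [Fintype E(G)] (hG : IsConnected G)
    (O : RefOrientation G) (q : V(G)) (z : {v : V(G) // v ≠ q} → ℝ) :
    ∃ p, incMatrix O q *ᵥ p = z := by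
  have h : LinearMap.range (incMatrix O q).mulVecLin = ⊤ := by
    apply Submodule.eq_top_of_finrank_eq
    rw [← Matrix.rank, rank_incMatrix hG, Module.finrank_fintype_fun_eq_card]
  exact LinearMap.range_eq_top.1 h z

end Incidence

/-! ### Directed cycles as circulations -/

section Cycles

variable [DecidableEq α] [Fintype E(G)]

/-- The product `y (e i) * x (e i)` is the amount that `y` carries in the direction of traversal,
whatever the reference orientation of `e i`. -/
theorem netFlow_eq_sum_cycle {n : ℕ} [NeZero n] {v : Fin n → V(G)} {e : Fin n → E(G)}
    {x y : E(G) → ℝ} (he : Function.Injective e)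
    (hx : ∀ i, (x (e i) = 1 ∧ O.tail (e i) = v i ∧ O.head (e i) = v (i + 1)) ∨
          (x (e i) = -1 ∧ O.head (e i) = v i ∧ O.tail (e i) = v (i + 1)))
    (hy : ∀ f, f ∉ Set.range e → y f = 0) (u : V(G)) :
    O.netFlow y u = ∑ i, y (e i) * x (e i) *
      ((if v (i + 1) = u then 1 else 0) - (if v i = u then 1 else 0)) := by
  symm
  apply Fintype.sum_of_injective e he
  · intro f hf
    rw [hy f hf, zero_mul]
  · intro i
    rcases hx i with ⟨h1, h2, h3⟩ | ⟨h1, h2, h3⟩ <;> rw [h1, h2, h3] <;> ring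

theorem IsDirectedCycle.netFlow {C : Set E(G)} {x : E(G) → ℝ} (h : IsDirectedCycle O C x)
    (u : V(G)) : O.netFlow x u = 0 := by
  obtain ⟨n, _, v, e, -, he, rfl, hx, hx0⟩ := h
  rw [netFlow_eq_sum_cycle he hx hx0]
  have h1 (i) : x (e i) * x (e i) = 1 := by
    rcases hx i with ⟨h, -⟩ | ⟨h, -⟩ <;> rw [h] <;> norm_num
  simp only [h1, one_mul, Finset.sum_sub_distrib]
  rw [sub_eq_zero]
  exact Equiv.sum_comp (Equiv.addRight (1 : Fin n)) (fun i ↦ if v i = u then (1 : ℝ) else 0)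

theorem IsDirectedCycle.mulVec_eq_zero {C : Set E(G)} {x : E(G) → ℝ}
    (h : IsDirectedCycle O C x) (q : V(G)) : incMatrix O q *ᵥ x = 0 := by
  funext v
  rw [incMatrix_mulVec, h.netFlow]; rfl

/-- The two vectors may come from different listings of `C`. Conservation of `y` at the vertices
listed for `x` makes the product `y * x` constant along the cycle, and it is `1` or `-1`. -/
theorem IsDirectedCycle.eq_or_eq_neg {C : Set E(G)} {x y : E(G) → ℝ}
    (hx : IsDirectedCycle O C x) (hy : IsDirectedCycle O C y) : y = x ∨ y = -x := by
  have hyC : ∀ f, f ∉ C → y f = 0 := by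
    obtain ⟨n, _, v, e, -, he, -, -, h⟩ := hy
    exact h
  have hyv : ∀ f ∈ C, y f = 1 ∨ y f = -1 := by
    obtain ⟨n, _, v, e, -, he, rfl, h, -⟩ := hy
    rintro _ ⟨i, rfl⟩
    exact (h i).imp And.left And.left
  have hyF := hy.netFlow
  obtain ⟨n, _, v, e, hv, he, rfl, hx, hx0⟩ := hx
  have hstep (i : Fin n) : y (e (i + 1)) * x (e (i + 1)) = y (e i) * x (e i) := by
    have h := hyF (v (i + 1))
    rw [netFlow_eq_sum_cycle he hx hyC] at h
    simp only [hv.eq_iff, add_left_inj, mul_sub, Finset.sum_sub_distrib, mul_ite, mul_one,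
      mul_zero, Finset.sum_ite_eq', Finset.mem_univ, if_true] at h
    linarith
  have hconst (i : Fin n) : y (e i) * x (e i) = y (e 0) * x (e 0) := by
    obtain ⟨k, hk⟩ := i
    induction k with
    | zero => rfl
    | succ k ih =>
      have : (⟨k + 1, hk⟩ : Fin n) = ⟨k, by omega⟩ + 1 := by
        ext
        rw [Fin.val_add, Fin.val_one', Nat.add_mod_mod, Nat.mod_eq_of_lt hk]
      rw [this, hstep, ih]
  have hx1 (i) : x (e i) = 1 ∨ x (e i) = -1 := (hx i).imp And.left And.left
  have hy1 (i) : y (e i) = 1 ∨ y (e i) = -1 := hyv _ ⟨i, rfl⟩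
  by_cases h0 : y (e 0) * x (e 0) = 1
  · left
    funext f
    by_cases hf : f ∈ Set.range e
    · obtain ⟨i, rfl⟩ := hf
      have := hconst i
      rw [h0] at this
      rcases hx1 i with h | h <;> rcases hy1 i with h' | h' <;> rw [h, h'] at this ⊢ <;>
        norm_num at this
    · rw [hx0 f hf, hyC f hf]
  · right
    funext f
    by_cases hf : f ∈ Set.range e
    · obtain ⟨i, rfl⟩ := hf
      have := hconst i
      rw [← this] at h0
      rcases hx1 i with h | h <;> rcases hy1 i with h' | h' <;>
        simp [h, h'] at h0 ⊢
    · simp [hx0 f hf, hyC f hf]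

end Cycles

/-! ### Finding directed cycles by walking -/

section Darts

/-- The start of an edge traversed along (`true`) or against (`false`) its orientation. -/
def RefOrientation.src (O : RefOrientation G) (e : E(G)) : Bool → V(G)
  | true => O.tail e
  | false => O.head e

/-- The end of an edge traversed along (`true`) or against (`false`) its orientation. -/
def RefOrientation.tgt (O : RefOrientation G) (e : E(G)) : Bool → V(G)
  | true => O.head e
  | false => O.tail e

theorem isLink_src_tgt (e : E(G)) (b : Bool) : G.IsLink e (O.src e b) (O.tgt e b) := by
  cases b
  · exact (O.isLink e).symm
  · exact O.isLink e

/-- A nonempty set of directed edges in which each one can be continued without turning back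
contains a directed cycle. -/
theorem exists_isDirectedCycle_of_continuable [Finite V(G)] (A : E(G) → Bool → Prop)
    (hne : ∃ e b, A e b)
    (hnext : ∀ e b, A e b → ∃ e' b', A e' b' ∧ O.src e' b' = O.tgt e b ∧ ¬ (e' = e ∧ b' = !b)) :
    ∃ C x, IsCycle G C ∧ C.Nonempty ∧ IsDirectedCycle O C x ∧
      ∀ f ∈ C, (x f = 1 ∧ A f true) ∨ (x f = -1 ∧ A f false) := by
  classical
  obtain ⟨e₀, b₀, h₀⟩ := hne
  have hnext' (p : {p : E(G) × Bool // A p.1 p.2}) : ∃ p' : {p : E(G) × Bool // A p.1 p.2},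
      O.src p'.1.1 p'.1.2 = O.tgt p.1.1 p.1.2 ∧ ¬ (p'.1.1 = p.1.1 ∧ p'.1.2 = !p.1.2) := by
    obtain ⟨e', b', h, h'⟩ := hnext _ _ p.2
    exact ⟨⟨(e', b'), h⟩, h'⟩
  choose φ hφ hφ' using hnext'
  let d (i : ℕ) : {p : E(G) × Bool // A p.1 p.2} := φ^[i] ⟨(e₀, b₀), h₀⟩
  let w (i : ℕ) : V(G) := O.src (d i).1.1 (d i).1.2
  have hd (i) : d (i + 1) = φ (d i) := Function.iterate_succ_apply' _ _ _
  have hw (i) : w (i + 1) = O.tgt (d i).1.1 (d i).1.2 := by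
    simp only [w, hd, hφ]
  have hback (i) : ¬ ((d (i + 1)).1.1 = (d i).1.1 ∧ (d (i + 1)).1.2 = !(d i).1.2) := by
    rw [hd]; exact hφ' _
  -- The walk revisits a vertex. A return of least length `m + 1` is a closed walk with distinct
  -- vertices.
  have hrep : ∃ m, ∃ i, w i = w (i + (m + 1)) := by
    obtain ⟨i, j, hij, h⟩ := Finite.exists_ne_map_eq_of_infinite w
    rcases lt_or_gt_of_ne hij with hlt | hlt
    · exact ⟨j - i - 1, i, by rw [h]; congr 1; omega⟩
    · exact ⟨i - j - 1, j, by rw [← h]; congr 1; omega⟩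
  obtain ⟨m, ⟨i, hi⟩, hmin⟩ : ∃ m, (∃ i, w i = w (i + (m + 1))) ∧
      ∀ k < m, ¬ ∃ i, w i = w (i + (k + 1)) :=
    ⟨Nat.find hrep, Nat.find_spec hrep, fun k hk ↦ Nat.find_min hrep hk⟩
  have hlt (a b : ℕ) (hab : a < b) (hb : b < m + 1) : w (i + a) ≠ w (i + b) := by
    intro h
    refine hmin (b - a - 1) (by omega) ⟨i + a, ?_⟩
    rw [h]; congr 1; omega
  have hinj (a b : ℕ) (ha : a < m + 1) (hb : b < m + 1) (h : w (i + a) = w (i + b)) : a = b := by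
    rcases lt_trichotomy a b with h' | h' | h'
    · exact (hlt a b h' hb h).elim
    · exact h'
    · exact (hlt b a h' ha h.symm).elim
  let v (k : Fin (m + 1)) : V(G) := w (i + k)
  let e (k : Fin (m + 1)) : E(G) := (d (i + k)).1.1
  have hv : Function.Injective v := fun a b h ↦ Fin.ext (hinj _ _ a.2 b.2 h)
  have hv1 (k : Fin (m + 1)) : v (k + 1) = w (i + k + 1) := by
    simp only [v]
    by_cases hk : k = Fin.last m
    · subst hk
      simp only [Fin.last_add_one, Fin.val_zero, Fin.val_last, add_zero]
      exact hi
    · rw [Fin.val_add_one_of_lt (Fin.lt_last_iff_ne_last.2 hk), add_assoc]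
  have htgt (k : Fin (m + 1)) : O.tgt (e k) (d (i + k)).1.2 = v (k + 1) := by
    rw [hv1, hw]
  -- An edge used twice in the same direction repeats its start vertex. Used in opposite directions,
  -- its second start is its first end, so `b = a + 1` and the walk turned back.
  have hee (a b : Fin (m + 1)) (hab : a.1 < b.1) : e a ≠ e b := by
    intro h
    by_cases hb : (d (i + b)).1.2 = (d (i + a)).1.2
    · refine hlt a b hab b.2 ?_
      simp only [w]
      rw [hb]
      exact congrArg (fun t ↦ O.src t _) h
    · have hb' : (d (i + b)).1.2 = !(d (i + a)).1.2 := by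
        revert hb
        cases (d (i + b)).1.2 <;> cases (d (i + a)).1.2 <;> simp
      have h1 : w (i + b) = w (i + (a + 1)) := by
        rw [← add_assoc, hw]
        simp only [w]
        rw [hb', ← show e b = (d (i + b)).1.1 from rfl, ← h]
        show O.src (e a) _ = O.tgt (e a) _
        cases (d (i + a)).1.2 <;> rfl
      have h2 := hinj _ _ b.2 (by omega) h1
      apply hback (i + a)
      rw [add_assoc, ← h2]
      exact ⟨h.symm, hb'⟩
  have he : Function.Injective e := by
    intro a b h
    rcases lt_trichotomy a.1 b.1 with h' | h' | h'
    · exact (hee a b h' h).elim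
    · exact Fin.ext h'
    · exact (hee b a h' h.symm).elim
  let x (f : E(G)) : ℝ :=
    if h : ∃ k, e k = f then (if (d (i + h.choose)).1.2 then 1 else -1) else 0
  have hx (k) : x (e k) = if (d (i + k)).1.2 then 1 else -1 := by
    have hk : ∃ l, e l = e k := ⟨k, rfl⟩
    have hk' : hk.choose = k := he hk.choose_spec
    simp only [x]
    rw [dif_pos hk, hk']
  refine ⟨Set.range e, x, ⟨m + 1, inferInstance, v, e, hv, he, fun k ↦ ?_, rfl⟩, ⟨e 0, 0, rfl⟩,
    ⟨m + 1, inferInstance, v, e, hv, he, rfl, fun k ↦ ?_, fun f hf ↦ dif_neg hf⟩, ?_⟩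
  · rw [← htgt]
    exact isLink_src_tgt (O := O) _ _
  · rw [hx, ← htgt]
    simp only [v, w]
    change _ ∧ _ = O.src (e k) _ ∧ _ ∨ _ ∧ _ = O.src (e k) _ ∧ _
    cases (d (i + k)).1.2 <;> simp [RefOrientation.src, RefOrientation.tgt]
  · rintro _ ⟨k, rfl⟩
    rw [hx]
    have hA := (d (i + k)).2
    change A (e k) _ at hA
    revert hA
    cases (d (i + k)).1.2 <;> intro hA <;> simp [hA]

end Darts
-- Compatible orientations and injectivity
section Compatible

theorem exists_pos_le_of_pos {ι : Type*} [Finite ι] (g : ι → ℝ) :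
    ∃ ε > 0, ∀ i, 0 < g i → ε ≤ g i := by
  have h : ∀ᶠ ε in nhdsWithin (0 : ℝ) (Set.Ioi 0), ∀ i, 0 < g i → ε ≤ g i := by
    refine Filter.eventually_all.2 fun i ↦ ?_
    by_cases hi : 0 < g i
    · filter_upwards [Ioo_mem_nhdsGT hi] with ε hε _ using hε.2.le
    · exact Filter.Eventually.of_forall fun _ h ↦ (hi h).elim
  obtain ⟨ε, h, hε⟩ := (h.and self_mem_nhdsWithin).exists
  exact ⟨ε, hε, h⟩

theorem CycleSignature.false_of_movable [DecidableEq α] [Fintype E(G)] (σ : CycleSignature O)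
    {s s' : E(G) → ℝ} (hs : s ∈ σ.compatible) (hs' : s' ∈ σ.compatible) {C : Set E(G)}
    {x : E(G) → ℝ} (hC : IsCycle G C) (hx : IsDirectedCycle O C x) {ε : ℝ} (hε : 0 < ε)
    (h : s + ε • x ∈ Set.Icc 0 1) (h' : s' - ε • x ∈ Set.Icc 0 1) : False := by
  rcases hx.eq_or_eq_neg (σ.isDirectedCycle ⟨C, hC⟩) with hd | hd
  · exact hs.2 ⟨C, hC⟩ ε hε (hd ▸ h)
  · refine hs'.2 ⟨C, hC⟩ ε hε ?_
    rw [hd, smul_neg, ← sub_eq_add_neg]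
    exact h'

/-- A nonzero circulation has the sign pattern of a directed cycle on the support of the latter. -/
theorem exists_conformal_cycle [DecidableEq α] [Fintype V(G)] [Fintype E(G)] {k : E(G) → ℝ}
    (hk : ∀ u, O.netFlow k u = 0) (hk0 : k ≠ 0) :
    ∃ C x, IsCycle G C ∧ C.Nonempty ∧ IsDirectedCycle O C x ∧
      ∀ f ∈ C, (x f = 1 ∧ 0 < k f) ∨ (x f = -1 ∧ k f < 0) := by
  refine exists_isDirectedCycle_of_continuable (fun e b ↦ if b then 0 < k e else k e < 0) ?_ ?_
    |>.imp fun C ⟨x, hC, hne, hx, h⟩ ↦ ⟨x, hC, hne, hx, by simpa using h⟩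
  · obtain ⟨e, he⟩ := Function.ne_iff.1 hk0
    rcases lt_or_gt_of_ne he with h | h
    · exact ⟨e, false, by simpa using h⟩
    · exact ⟨e, true, by simpa using h⟩
  · intro e b hA
    -- If the walk cannot continue, every term of the net flow at the end vertex is nonnegative. The
    -- sum is zero, so the term of `e` vanishes, which contradicts the sign of `k e`; if `e` is a
    -- loop, it could continue itself.
    by_contra hno
    have hno' (e' b') (hA' : if b' = true then 0 < k e' else k e' < 0) :
        O.src e' b' ≠ O.tgt e b := by
      intro hsrc
      refine hno ⟨e', b', hA', hsrc, ?_⟩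
      rintro ⟨rfl, rfl⟩
      cases b <;> simp at hA hA' <;> linarith
    have htail (f) (hf : O.tail f = O.tgt e b) : k f ≤ 0 :=
      not_lt.1 fun h ↦ hno' f true (by simpa using h) hf
    have hhead (f) (hf : O.head f = O.tgt e b) : 0 ≤ k f :=
      not_lt.1 fun h ↦ hno' f false (by simpa using h) hf
    have hsum := (Finset.sum_eq_zero_iff_of_nonneg (fun f _ ↦ by
      split_ifs with h1 h2 h2
      · simp
      · simpa using hhead f h1
      · simpa using htail f h2
      · simp)).1 (hk (O.tgt e b)) e (Finset.mem_univ e)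
    cases b
    · have ht : O.tail e = O.tgt e false := rfl
      have hA' : k e < 0 := by simpa using hA
      rw [if_pos ht] at hsum
      split_ifs at hsum with h3
      · linarith [hhead e h3]
      · linarith
    · have hh : O.head e = O.tgt e true := rfl
      have hA' : 0 < k e := by simpa using hA
      rw [if_pos hh] at hsum
      split_ifs at hsum with h3
      · linarith [htail e h3]
      · linarith

/-- On a cycle conformal to `k`, the entries of `s` and `s'` differ by at least `ε` in the direction
of `x`. Moving `s'` along `x` and `s` along `-x` by `ε` therefore keeps both in the cube. -/
theorem CycleSignature.eq_zero_of_mulVec_eq_zero [DecidableEq α] [Fintype V(G)] [Fintype E(G)]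
    (σ : CycleSignature O) (q : V(G)) {s s' k : E(G) → ℝ} (hs : s ∈ σ.compatible)
    (hs' : s' ∈ σ.compatible) (hk : incMatrix O q *ᵥ k = 0)
    (h : ∀ e, k e = 0 ∨ k e = s e - s' e) : k = 0 := by
  by_contra hk0
  obtain ⟨C, x, hC, -, hx, hconf⟩ := exists_conformal_cycle (netFlow_eq_zero hk) hk0
  obtain ⟨ε, hε, hle⟩ := exists_pos_le_of_pos fun e ↦ |k e|
  have hx0 : ∀ f, f ∉ C → x f = 0 := by
    obtain ⟨n, _, v, e, -, he, -, -, h⟩ := hx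
    exact h
  have key (f) : (0 ≤ s' f + ε * x f ∧ s' f + ε * x f ≤ 1) ∧
      (0 ≤ s f - ε * x f ∧ s f - ε * x f ≤ 1) := by
    have a1 := hs.1.1 f
    have a2 := hs.1.2 f
    have a3 := hs'.1.1 f
    have a4 := hs'.1.2 f
    simp only [Pi.zero_apply, Pi.one_apply] at a1 a2 a3 a4
    by_cases hf : f ∈ C
    · rcases hconf f hf with ⟨h1, h2⟩ | ⟨h1, h2⟩
      · have h3 := hle f (abs_pos.2 h2.ne')
        rw [abs_of_pos h2] at h3
        rcases h f with h4 | h4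
        · linarith
        · rw [h1]
          refine ⟨⟨?_, ?_⟩, ?_, ?_⟩ <;> linarith
      · have h3 := hle f (abs_pos.2 h2.ne)
        rw [abs_of_neg h2] at h3
        rcases h f with h4 | h4
        · linarith
        · rw [h1]
          refine ⟨⟨?_, ?_⟩, ?_, ?_⟩ <;> linarith
    · rw [hx0 f hf]
      refine ⟨⟨?_, ?_⟩, ?_, ?_⟩ <;> linarith
  exact σ.false_of_movable hs' hs hC hx hε ⟨fun f ↦ (key f).1.1, fun f ↦ (key f).1.2⟩
    ⟨fun f ↦ (key f).2.1, fun f ↦ (key f).2.2⟩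

theorem dotProduct_transpose_mulVec {m n : Type*} [Fintype m] [Fintype n] (D : Matrix m n ℝ)
    (y : n → ℝ) (g : m → ℝ) : ∑ e, y e * (Dᵀ *ᵥ g) e = ∑ v, (D *ᵥ y) v * g v := by
  change y ⬝ᵥ (Dᵀ *ᵥ g) = (D *ᵥ y) ⬝ᵥ g
  rw [Matrix.mulVec_transpose, dotProduct_comm, ← Matrix.dotProduct_mulVec, dotProduct_comm]

theorem CycleSignature.injOn_extendedSection [DecidableEq α] [Fintype V(G)] [Fintype E(G)]
    (σ : CycleSignature O) (q : V(G)) :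
    Set.InjOn (fun x ↦ incMatrix O q *ᵥ x) (σ.extendedSection q) := by
  rintro _ ⟨s, hs, y, ⟨⟨g, hg⟩, hy⟩, rfl⟩ _ ⟨s', hs', y', ⟨⟨g', hg'⟩, hy'⟩, rfl⟩ heq
  dsimp only at heq ⊢
  rw [← sub_eq_zero] at heq ⊢
  rw [← Matrix.mulVec_sub] at heq
  rw [Matrix.mulVecLin_apply] at hg hg'
  set k := s + y - (s' + y') with hkdef
  have hz (e) : ∃ n : ℤ, y e - y' e = n := by
    obtain ⟨a, ha⟩ := hy e
    obtain ⟨b, hb⟩ := hy' e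
    exact ⟨a - b, by rw [ha, hb]; push_cast; rfl⟩
  have hke (e) : k e = s e - s' e + (y e - y' e) := by
    simp only [hkdef, Pi.sub_apply, Pi.add_apply]; ring
  have hpair : ∑ e, k e * (y e - y' e) = 0 := by
    have := dotProduct_transpose_mulVec (incMatrix O q) k (g - g')
    rw [heq, Matrix.mulVec_sub, hg, hg'] at this
    simpa using this
  -- A nonzero integer `y e - y' e` has absolute value at least `1 ≥ |s e - s' e|`, so it decides
  -- the sign of `k e`.
  have hnonneg (e) : 0 ≤ k e * (y e - y' e) := by
    have a1 := hs.1.1 e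
    have a2 := hs.1.2 e
    have a3 := hs'.1.1 e
    have a4 := hs'.1.2 e
    simp only [Pi.zero_apply, Pi.one_apply] at a1 a2 a3 a4
    rw [hke]
    obtain ⟨n, hn⟩ := hz e
    rw [hn]
    rcases lt_trichotomy n 0 with h | h | h
    · have : (n : ℝ) ≤ -1 := by exact_mod_cast (by omega : n ≤ -1)
      exact mul_nonneg_of_nonpos_of_nonpos (by linarith) (by linarith)
    · simp [h]
    · have : (1 : ℝ) ≤ n := by exact_mod_cast h
      exact mul_nonneg (by linarith) (by linarith)
  refine σ.eq_zero_of_mulVec_eq_zero q hs hs' heq fun e ↦ ?_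
  have := (Finset.sum_eq_zero_iff_of_nonneg fun e _ ↦ hnonneg e).1 hpair e (Finset.mem_univ e)
  rcases mul_eq_zero.1 this with h | h
  · exact Or.inl h
  · right
    rw [hke, h, add_zero]

theorem zero_mem_imInt {m n : Type*} [Fintype m] (D : Matrix m n ℝ) : 0 ∈ imInt D :=
  ⟨Submodule.zero_mem _, fun _ ↦ ⟨0, by simp⟩⟩

theorem CycleSignature.compatible_subset_extendedSection [DecidableEq α] [Fintype V(G)]
    [Fintype E(G)] (σ : CycleSignature O) (q : V(G)) : σ.compatible ⊆ σ.extendedSection q :=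
  fun x hx ↦ ⟨x, hx, 0, zero_mem_imInt _, add_zero x⟩

end Compatible

/-! ### Lattice points -/

section Integrality

theorem mem_range_intCast_iff {x : ℝ} : x ∈ (Int.castRingHom ℝ).range ↔ ∃ k : ℤ, x = k := by
  simp [RingHom.mem_range, eq_comm]

theorem mulVec_mem_latticePoints [DecidableEq α] [Fintype E(G)] (q : V(G)) {x : E(G) → ℝ}
    (hx : x ∈ latticePoints E(G)) :
    incMatrix O q *ᵥ x ∈ latticePoints {v : V(G) // v ≠ q} := by
  intro v
  rw [incMatrix_mulVec, ← mem_range_intCast_iff, RefOrientation.netFlow]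
  refine sum_mem fun e _ ↦ mul_mem (mem_range_intCast_iff.2 (hx e)) (sub_mem ?_ ?_) <;>
    split_ifs <;> first | exact one_mem _ | exact zero_mem _

/-- With integral net flow, a vertex cannot meet exactly one non-integral non-loop edge and no other
non-integral edge, so non-integral edges continue to a cycle. Its entries lie strictly between `0`
and `1`, so `s` can be moved along it in both directions. -/
theorem CycleSignature.mem_latticePoints_of_compatible [DecidableEq α] [Fintype V(G)]
    [Fintype E(G)] (σ : CycleSignature O) (q : V(G)) {s : E(G) → ℝ} (hs : s ∈ σ.compatible)
    (h : incMatrix O q *ᵥ s ∈ latticePoints {v : V(G) // v ≠ q}) :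
    s ∈ latticePoints E(G) := by
  classical
  have hflow (u) : O.netFlow s u ∈ (Int.castRingHom ℝ).range := by
    by_cases hu : u = q
    · subst hu
      rw [netFlow_root]
      exact neg_mem (sum_mem fun v _ ↦ mem_range_intCast_iff.2 (h v))
    · rw [← incMatrix_mulVec q s ⟨u, hu⟩]
      exact mem_range_intCast_iff.2 (h _)
  by_contra hns
  obtain ⟨C, x, hC, -, hx, hA⟩ := exists_isDirectedCycle_of_continuable (O := O)
    (fun e _ ↦ s e ∉ (Int.castRingHom ℝ).range) (by
      simp only [latticePoints, Set.mem_ofPred_eq, not_forall] at hns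
      obtain ⟨e, he⟩ := hns
      exact ⟨e, true, fun h ↦ he (mem_range_intCast_iff.1 h)⟩) (by
      intro e b he
      -- A loop contributes nothing to the net flow, so integrality says nothing about it; it
      -- continues itself in the same direction.
      by_cases hloop : O.head e = O.tail e
      · refine ⟨e, b, he, ?_, by simp⟩
        cases b <;> simp [RefOrientation.src, RefOrientation.tgt, hloop]
      by_contra hno
      have hint (f) (hf : f ≠ e) (b') (hb : O.src f b' = O.tgt e b) :
          s f ∈ (Int.castRingHom ℝ).range := by
        by_contra hf'
        exact hno ⟨f, b', hf', hb, fun h ↦ hf h.1⟩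
      have hsum := hflow (O.tgt e b)
      rw [RefOrientation.netFlow, ← Finset.add_sum_erase _ _ (Finset.mem_univ e)] at hsum
      have hrest : ∑ f ∈ Finset.univ.erase e, s f * ((if O.head f = O.tgt e b then 1 else 0) -
          (if O.tail f = O.tgt e b then 1 else 0)) ∈ (Int.castRingHom ℝ).range := by
        refine sum_mem fun f hf ↦ ?_
        have hfe := (Finset.mem_erase.1 hf).1
        split_ifs with h1 h2 h2
        · simp
        · simpa using hint f hfe false h1
        · simpa using hint f hfe true h2
        · simp
      have hterm := sub_mem hsum hrest
      rw [add_sub_cancel_right] at hterm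
      apply he
      cases b
      · simpa [RefOrientation.tgt, hloop] using hterm
      · simpa [RefOrientation.tgt, Ne.symm hloop] using hterm)
  obtain ⟨ε, hε, hle⟩ := exists_pos_le_of_pos fun e ↦ min (s e) (1 - s e)
  have hx0 : ∀ f, f ∉ C → x f = 0 := by
    obtain ⟨n, _, v, e, -, he, -, -, h⟩ := hx
    exact h
  have key (f) : (0 ≤ s f + ε * x f ∧ s f + ε * x f ≤ 1) ∧
      (0 ≤ s f - ε * x f ∧ s f - ε * x f ≤ 1) := by
    have a1 := hs.1.1 f
    have a2 := hs.1.2 f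
    simp only [Pi.zero_apply, Pi.one_apply] at a1 a2
    by_cases hf : f ∈ C
    · have hni : s f ∉ (Int.castRingHom ℝ).range := by
        rcases hA f hf with h | h <;> exact h.2
      have h0 : 0 < s f := lt_of_le_of_ne a1 fun h ↦ hni (h ▸ zero_mem _)
      have h1 : s f < 1 := lt_of_le_of_ne a2 fun h ↦ hni (h ▸ one_mem _)
      obtain ⟨h2, h3⟩ := le_min_iff.1 (hle f (lt_min h0 (by linarith)))
      rcases hA f hf with h | h <;> rw [h.1] <;> refine ⟨⟨?_, ?_⟩, ?_, ?_⟩ <;> linarith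
    · rw [hx0 f hf]
      refine ⟨⟨?_, ?_⟩, ?_, ?_⟩ <;> linarith
  exact σ.false_of_movable hs hs hC hx hε ⟨fun f ↦ (key f).1.1, fun f ↦ (key f).1.2⟩
    ⟨fun f ↦ (key f).2.1, fun f ↦ (key f).2.2⟩

theorem CycleSignature.mem_latticePoints_iff [DecidableEq α] [Fintype V(G)]
    [Fintype E(G)] (σ : CycleSignature O) (q : V(G)) {x : E(G) → ℝ}
    (hx : x ∈ σ.extendedSection q) :
    x ∈ latticePoints E(G) ↔ incMatrix O q *ᵥ x ∈ latticePoints {v : V(G) // v ≠ q} := by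
  refine ⟨mulVec_mem_latticePoints q, fun h ↦ ?_⟩
  obtain ⟨s, hs, y, hy, rfl⟩ := hx
  have hDs : incMatrix O q *ᵥ s ∈ latticePoints {v : V(G) // v ≠ q} := by
    intro v
    obtain ⟨a, ha⟩ := h v
    obtain ⟨b, hb⟩ := mulVec_mem_latticePoints (O := O) q hy.2 v
    refine ⟨a - b, ?_⟩
    rw [Matrix.mulVec_add, Pi.add_apply] at ha
    push_cast
    linarith
  intro e
  obtain ⟨a, ha⟩ := σ.mem_latticePoints_of_compatible q hs hDs e
  obtain ⟨b, hb⟩ := hy.2 e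
  exact ⟨a + b, by simp [ha, hb]⟩

end Integrality

/-! ### Compatible representatives in the fibres of the cube -/

section Existence

/-- Gordan's alternative for an acyclic signature. -/
theorem CycleSignature.IsAcyclic.exists_pos [Fintype E(G)] {σ : CycleSignature O}
    (hσ : σ.IsAcyclic) : ∃ f : (E(G) → ℝ) →L[ℝ] ℝ, ∀ C, 0 < f (σ.dir C) := by
  classical
  let L : ({C : Set E(G) // IsCycle G C} → ℝ) →ₗ[ℝ] (E(G) → ℝ) :=
    ∑ C, (LinearMap.proj C).smulRight (σ.dir C)
  have hL (a) : L a = ∑ C, a C • σ.dir C := by simp [L]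
  -- `K` is the convex hull of the chosen directions. It misses `0` because coefficients summing to
  -- `1` cannot all vanish; a hyperplane separating `0` from `K` gives the functional.
  let K := L '' stdSimplex ℝ {C : Set E(G) // IsCycle G C}
  have hK : Convex ℝ K := (convex_stdSimplex ℝ _).linear_image L
  have hKc : IsCompact K := (isCompact_stdSimplex ℝ _).image L.continuous_of_finiteDimensional
  have h0 : (0 : E(G) → ℝ) ∉ K := by
    rintro ⟨a, ha, h⟩
    rw [hL] at h
    have := hσ a ha.1 h
    simpa [this] using ha.2
  obtain ⟨f, u, hu, h⟩ := geometric_hahn_banach_point_closed hK hKc.isClosed h0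
  refine ⟨f, fun C ↦ ?_⟩
  have hC : σ.dir C ∈ K := ⟨Pi.single C 1, single_mem_stdSimplex ℝ C, by
    rw [hL, Finset.sum_eq_single C]
    · simp
    · intro b _ hb
      simp [hb]
    · simp⟩
  rw [map_zero] at hu
  exact hu.trans (h _ hC)

/-- Maximize a functional positive on all `σ(C)` over the fibre in the cube. A move along `σ(C)`
stays in the fibre and would increase it. -/
theorem CycleSignature.IsAcyclic.exists_compatible [DecidableEq α] [Fintype E(G)]
    {σ : CycleSignature O} (hσ : σ.IsAcyclic) (q : V(G)) {x : E(G) → ℝ}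
    (hx : x ∈ Set.Icc (0 : E(G) → ℝ) 1) :
    ∃ s ∈ σ.compatible, incMatrix O q *ᵥ s = incMatrix O q *ᵥ x := by
  obtain ⟨f, hf⟩ := hσ.exists_pos
  have hcont : Continuous fun s ↦ incMatrix O q *ᵥ s :=
    (incMatrix O q).mulVecLin.continuous_of_finiteDimensional
  have hK : IsCompact (Set.Icc (0 : E(G) → ℝ) 1 ∩
      {s | incMatrix O q *ᵥ s = incMatrix O q *ᵥ x}) :=
    isCompact_Icc.inter_right (isClosed_eq hcont continuous_const)
  obtain ⟨s, ⟨hs, hsx⟩, hmax⟩ := hK.exists_isMaxOn ⟨x, hx, rfl⟩ f.continuous.continuousOn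
  refine ⟨s, ⟨hs, fun C ε hε hmem ↦ ?_⟩, hsx⟩
  have h1 : f (s + ε • σ.dir C) ≤ f s := hmax ⟨hmem, by
    rw [Set.mem_ofPred_eq, Matrix.mulVec_add, Matrix.mulVec_smul,
      (σ.isDirectedCycle C).mulVec_eq_zero, smul_zero, add_zero]
    exact hsx⟩
  rw [map_add, map_smul, smul_eq_mul] at h1
  linarith [mul_pos hε (hf C)]

theorem mem_zonotope_iff {m n : Type*} [Fintype n] (D : Matrix m n ℝ) (z : m → ℝ) :
    z ∈ zonotope D ↔ ∃ x ∈ Set.Icc (0 : n → ℝ) 1, D *ᵥ x = z := by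
  have h (c : n → ℝ) : ∑ e, c e • D.col e = D *ᵥ c := by
    funext v
    simp [Matrix.mulVec, dotProduct, Matrix.col_apply, mul_comm]
  simp only [zonotope, Set.mem_ofPred_eq, h]
  exact exists_congr fun c ↦ and_congr
    ⟨fun h ↦ ⟨fun e ↦ (h e).1, fun e ↦ (h e).2⟩, fun h e ↦ ⟨h.1 e, h.2 e⟩⟩ eq_comm

end Existence

/-! ### Covering space by lattice translates of the zonotope -/

section Covering

/-- An injective linear map is proper and the integer points leave every compact set, so the squared
distance tends to infinity and its minimum is attained. -/
theorem exists_nearest_lattice_point {m n : Type*} [Fintype m] [Fintype n] (D : Matrix m n ℝ)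
    (hD : Function.Injective Dᵀ.mulVecLin) (p : n → ℝ) :
    ∃ a : m → ℤ, ∀ b : m → ℤ, ∑ e, (p e - (Dᵀ *ᵥ fun v ↦ (a v : ℝ)) e) ^ 2 ≤
      ∑ e, (p e - (Dᵀ *ᵥ fun v ↦ (b v : ℝ)) e) ^ 2 := by
  have h1 : Filter.Tendsto (fun (a : m → ℤ) v ↦ (a v : ℝ)) Filter.cofinite
      (Filter.cocompact (m → ℝ)) := by
    rw [← Filter.coprodᵢ_cofinite, ← Filter.coprodᵢ_cocompact]
    exact Filter.Tendsto.pi_map_coprodᵢ fun _ ↦ Int.tendsto_coe_cofinite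
  have h2 : Filter.Tendsto Dᵀ.mulVecLin (Filter.cocompact (m → ℝ)) (Filter.cocompact (n → ℝ)) :=
    (LinearMap.isClosedEmbedding_of_injective (LinearMap.ker_eq_bot.2 hD)).tendsto_cocompact
  have h3 : Filter.Tendsto (fun y : n → ℝ ↦ ∑ e, (p e - y e) ^ 2) (Filter.cocompact (n → ℝ))
      Filter.atTop := by
    refine Filter.tendsto_atTop_mono (f := fun y ↦ ‖y‖ + (-‖p‖ - 1)) (fun y ↦ ?_)
      (Filter.tendsto_atTop_add_const_right _ _ tendsto_norm_cocompact_atTop)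
    have hn : ‖p - y‖ ≤ 1 + ∑ e, (p e - y e) ^ 2 := by
      refine (pi_norm_le_iff_of_nonneg (by positivity)).2 fun e ↦ ?_
      have := Finset.single_le_sum (f := fun e ↦ (p e - y e) ^ 2) (fun e _ ↦ sq_nonneg _)
        (Finset.mem_univ e)
      rw [Real.norm_eq_abs, Pi.sub_apply]
      rw [← sq_abs] at this
      nlinarith [sq_nonneg (|p e - y e| - 1), abs_nonneg (p e - y e)]
    have := norm_sub_norm_le y p
    rw [norm_sub_rev] at this
    linarith
  exact (h3.comp (h2.comp h1)).exists_forall_le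

/-- Variational inequality for the point of the cube whose image is nearest to a given one. -/
theorem exists_nearest_in_cube {m n : Type*} [Fintype m] [Fintype n] (D : Matrix m n ℝ)
    (w : n → ℝ) : ∃ s ∈ Set.Icc (0 : n → ℝ) 1, ∀ s' ∈ Set.Icc (0 : n → ℝ) 1,
      ∑ e, (s' e - s e) * (Dᵀ *ᵥ (D *ᵥ (w - s))) e ≤ 0 := by
  have hcont : Continuous fun s : n → ℝ ↦ ∑ v, ((D *ᵥ (w - s)) v) ^ 2 := by
    have h : Continuous fun s ↦ D *ᵥ s := D.mulVecLin.continuous_of_finiteDimensional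
    exact continuous_finsetSum _ fun v _ ↦
      ((continuous_apply v).comp (h.comp (continuous_const.sub continuous_id))).pow 2
  obtain ⟨s, hs, hmin⟩ := (isCompact_Icc (a := (0 : n → ℝ)) (b := 1)).exists_isMinOn
    ⟨0, le_rfl, zero_le_one⟩ hcont.continuousOn
  refine ⟨s, hs, fun s' hs' ↦ ?_⟩
  have hdot := dotProduct_transpose_mulVec D (s' - s) (D *ᵥ (w - s))
  simp only [Pi.sub_apply] at hdot
  rw [hdot]
  set f := D *ᵥ (w - s) with hf
  set g := D *ᵥ (s' - s) with hg
  by_contra! hA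
  set A := ∑ v, g v * f v with hAdef
  set B := ∑ v, g v ^ 2 with hBdef
  have hB : 0 ≤ B := Finset.sum_nonneg fun v _ ↦ sq_nonneg _
  -- Moving by `t` towards `s'` changes the squared distance by `t * (t * B - 2 * A)`. The choice `t
  -- = A / (A + B)` makes this negative, stays at most `1`, and is defined even when `B = 0`.
  have ht : 0 < A / (A + B) := by positivity
  have ht1 : A / (A + B) ≤ 1 := (div_le_one (by positivity)).2 (by linarith)
  set t := A / (A + B) with htdef
  have hmem : s + t • (s' - s) ∈ Set.Icc (0 : n → ℝ) 1 :=
    (convex_Icc (0 : n → ℝ) 1).add_smul_sub_mem hs hs' ⟨ht.le, ht1⟩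
  have h := isMinOn_iff.1 hmin _ hmem
  have hval : D *ᵥ (w - (s + t • (s' - s))) = f - t • g := by
    rw [hf, hg, ← Matrix.mulVec_smul, ← Matrix.mulVec_sub, sub_sub]
  have hexp : ∑ v, ((f - t • g) v) ^ 2 = ∑ v, f v ^ 2 - 2 * t * A + t ^ 2 * B := by
    rw [hAdef, hBdef, Finset.mul_sum, Finset.mul_sum, ← Finset.sum_sub_distrib,
      ← Finset.sum_add_distrib]
    refine Finset.sum_congr rfl fun v _ ↦ ?_
    simp only [Pi.sub_apply, Pi.smul_apply, smul_eq_mul]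
    ring
  rw [hval, hexp] at h
  have htA : t * (A + B) = A := by
    rw [htdef]; field_simp
  have h2 : 2 * A ≤ t * B := by
    by_contra! hlt
    nlinarith
  nlinarith

/-- The hypothesis says that `w - 1/2` lies in the Voronoi cell of `0` for the integral cuts. Let
`s` be a cube point with `D s` nearest to `D w`, and let `f` be the residual. By the variational
inequality, `s e` is `1` or `0` according to whether `Dᵀ f` is positive or negative at `e`. Testing
the hypothesis on the cuts of `{f > 0}` and `{f < 0}` shows that both sets are empty. -/
theorem exists_cube_mulVec_eq [DecidableEq α] [Fintype V(G)] [Fintype E(G)] (q : V(G))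
    (w : E(G) → ℝ)
    (hw : ∀ b : {v : V(G) // v ≠ q} → ℤ,
      2 * ∑ e, (w e - 1 / 2) * ((incMatrix O q)ᵀ *ᵥ fun v ↦ (b v : ℝ)) e ≤
        ∑ e, (((incMatrix O q)ᵀ *ᵥ fun v ↦ (b v : ℝ)) e) ^ 2) :
    ∃ s ∈ Set.Icc (0 : E(G) → ℝ) 1, incMatrix O q *ᵥ s = incMatrix O q *ᵥ w := by
  classical
  obtain ⟨s, hs, hvar⟩ := exists_nearest_in_cube (incMatrix O q) w
  refine ⟨s, hs, ?_⟩
  set f := incMatrix O q *ᵥ (w - s) with hf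
  have hpoint (e : E(G)) (t : ℝ) (ht0 : 0 ≤ t) (ht1 : t ≤ 1) :
      (t - s e) * ((incMatrix O q)ᵀ *ᵥ f) e ≤ 0 := by
    have h := hvar (Function.update s e t)
      ⟨le_update_iff.2 ⟨ht0, fun j _ ↦ hs.1 j⟩, update_le_iff.2 ⟨ht1, fun j _ ↦ hs.2 j⟩⟩
    rw [Finset.sum_eq_single e] at h
    · simpa using h
    · intro j _ hj
      simp [hj]
    · simp
  have hcut (b : {v : V(G) // v ≠ q} → ℤ)
      (hb : ∀ e, ((incMatrix O q)ᵀ *ᵥ fun v ↦ (b v : ℝ)) e = 0 ∨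
        (((incMatrix O q)ᵀ *ᵥ fun v ↦ (b v : ℝ)) e = 1 ∧ 0 < ((incMatrix O q)ᵀ *ᵥ f) e) ∨
        (((incMatrix O q)ᵀ *ᵥ fun v ↦ (b v : ℝ)) e = -1 ∧ ((incMatrix O q)ᵀ *ᵥ f) e < 0)) :
      ∑ v, f v * (b v : ℝ) ≤ 0 := by
    rw [hf, ← dotProduct_transpose_mulVec]
    have h := hw b
    set c := (incMatrix O q)ᵀ *ᵥ fun v ↦ (b v : ℝ)
    -- On the support of `c`, `s e - 1/2` equals `c e / 2`, so `s` attains equality in the Voronoi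
    -- inequality for `c`.
    have hsat : ∑ e, c e ^ 2 = 2 * ∑ e, (s e - 1 / 2) * c e := by
      rw [Finset.mul_sum]
      refine Finset.sum_congr rfl fun e _ ↦ ?_
      have a1 := hs.1 e
      have a2 := hs.2 e
      simp only [Pi.zero_apply, Pi.one_apply] at a1 a2
      rcases hb e with h0 | ⟨h0, hpos⟩ | ⟨h0, hneg⟩
      · rw [h0]; ring
      · have := nonpos_of_mul_nonpos_left (hpoint e 1 zero_le_one le_rfl) hpos
        have hse : s e = 1 := by linarith
        rw [h0, hse]; norm_num
      · have : 0 ≤ 0 - s e := by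
          by_contra! hlt
          linarith [mul_pos_of_neg_of_neg hlt hneg, hpoint e 0 le_rfl zero_le_one]
        have hse : s e = 0 := by linarith
        rw [h0, hse]; norm_num
    have hsplit : ∑ e, (w - s) e * c e =
        ∑ e, (w e - 1 / 2) * c e - ∑ e, (s e - 1 / 2) * c e := by
      rw [← Finset.sum_sub_distrib]
      exact Finset.sum_congr rfl fun e _ ↦ by simp only [Pi.sub_apply]; ring
    linarith
  have hle (v) : f v ≤ 0 := by
    -- The root has potential `0` and so lies outside `{f > 0}`. An edge crossing the boundary of
    -- this set has its jump in `f` of the same sign as its jump in the indicator.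
    have h := hcut (fun v ↦ if 0 < f v then 1 else 0) (fun e ↦ by
      have hext (u : V(G)) : extendPotential q
          (fun v ↦ (((if 0 < f v then 1 else 0 : ℤ)) : ℝ)) u =
            if 0 < extendPotential q f u then 1 else 0 := by
        unfold extendPotential
        split_ifs <;> simp_all
      rw [incMatrix_transpose_mulVec, incMatrix_transpose_mulVec, hext, hext]
      split_ifs with h1 h2 h2
      · simp
      · right; left
        constructor
        · norm_num
        · linarith
      · right; right
        constructor
        · norm_num
        · linarith
      · simp)
    have hnn (v) : 0 ≤ f v * (((if 0 < f v then 1 else 0 : ℤ)) : ℝ) := by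
      split_ifs with h1 <;> simp [le_of_lt, h1]
    have h0 := (Finset.sum_eq_zero_iff_of_nonneg fun v _ ↦ hnn v).1
      (le_antisymm h (Finset.sum_nonneg fun v _ ↦ hnn v)) v (Finset.mem_univ v)
    by_contra! hv
    simp [hv, hv.ne'] at h0
  have hge (v) : 0 ≤ f v := by
    have h := hcut (fun v ↦ if f v < 0 then -1 else 0) (fun e ↦ by
      have hext (u : V(G)) : extendPotential q
          (fun v ↦ (((if f v < 0 then -1 else 0 : ℤ)) : ℝ)) u =
            if extendPotential q f u < 0 then -1 else 0 := by
        unfold extendPotential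
        split_ifs <;> simp_all
      rw [incMatrix_transpose_mulVec, incMatrix_transpose_mulVec, hext, hext]
      split_ifs with h1 h2 h2
      · simp
      · right; right
        constructor
        · norm_num
        · linarith
      · right; left
        constructor
        · norm_num
        · linarith
      · simp)
    have hnn (v) : 0 ≤ f v * (((if f v < 0 then -1 else 0 : ℤ)) : ℝ) := by
      split_ifs with h1 <;> simp [le_of_lt, h1]
    have h0 := (Finset.sum_eq_zero_iff_of_nonneg fun v _ ↦ hnn v).1
      (le_antisymm h (Finset.sum_nonneg fun v _ ↦ hnn v)) v (Finset.mem_univ v)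
    by_contra! hv
    simp [hv, hv.ne] at h0
  have hf0 : f = 0 := funext fun v ↦ le_antisymm (hle v) (hge v)
  rw [hf, Matrix.mulVec_sub, sub_eq_zero] at hf0
  exact hf0.symm

theorem transpose_mulVec_intCast_mem_imInt [DecidableEq α] [Fintype V(G)] (q : V(G))
    (a : {v : V(G) // v ≠ q} → ℤ) :
    ((incMatrix O q)ᵀ *ᵥ fun v ↦ (a v : ℝ)) ∈ imInt (incMatrix O q) := by
  refine ⟨⟨fun v ↦ (a v : ℝ), rfl⟩, fun e ↦ ?_⟩
  rw [← mem_range_intCast_iff, incMatrix_transpose_mulVec]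
  refine sub_mem ?_ ?_ <;> unfold extendPotential <;> split_ifs <;> first
    | exact zero_mem _
    | exact mem_range_intCast_iff.2 ⟨_, rfl⟩

/-- The integral cuts translate the zonotope to cover the whole space. -/
theorem exists_cube_add_imInt [DecidableEq α] [Fintype V(G)] [Fintype E(G)] (hG : IsConnected G)
    (O : RefOrientation G) (q : V(G)) (z : {v : V(G) // v ≠ q} → ℝ) :
    ∃ s ∈ Set.Icc (0 : E(G) → ℝ) 1, ∃ y ∈ imInt (incMatrix O q),
      incMatrix O q *ᵥ (s + y) = z := by
  obtain ⟨p, rfl⟩ := incMatrix_surjective hG O q z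
  obtain ⟨a, ha⟩ := exists_nearest_lattice_point (incMatrix O q)
    (incMatrix_transpose_injective hG O q) (fun e ↦ p e - 1 / 2)
  obtain ⟨s, hs, h⟩ := exists_cube_mulVec_eq (O := O) q
    (p - (incMatrix O q)ᵀ *ᵥ fun v ↦ (a v : ℝ)) (fun b ↦ by
      have h := ha (a + b)
      have hadd : ((incMatrix O q)ᵀ *ᵥ fun v ↦ (((a + b) v : ℤ) : ℝ)) =
          ((incMatrix O q)ᵀ *ᵥ fun v ↦ (a v : ℝ)) + (incMatrix O q)ᵀ *ᵥ fun v ↦ (b v : ℝ) := by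
        rw [← Matrix.mulVec_add]
        congr 1
        funext v
        simp
      rw [hadd, ← sub_nonneg, ← Finset.sum_sub_distrib] at h
      rw [← sub_nonneg, Finset.mul_sum, ← Finset.sum_sub_distrib]
      refine h.trans_eq (Finset.sum_congr rfl fun e _ ↦ ?_)
      simp only [Pi.add_apply, Pi.sub_apply]
      ring)
  refine ⟨s, hs, _, transpose_mulVec_intCast_mem_imInt q a, ?_⟩
  rw [Matrix.mulVec_add, h, ← Matrix.mulVec_add, sub_add_cancel]

theorem CycleSignature.IsAcyclic.bijOn_extendedSection [DecidableEq α] [Fintype V(G)]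
    [Fintype E(G)] {σ : CycleSignature O} (hσ : σ.IsAcyclic) (hG : IsConnected G) (q : V(G)) :
    Set.BijOn (fun x ↦ incMatrix O q *ᵥ x) (σ.extendedSection q) Set.univ := by
  refine ⟨Set.mapsTo_univ _ _, σ.injOn_extendedSection q, fun z _ ↦ ?_⟩
  obtain ⟨x, hx, y, hy, h⟩ := exists_cube_add_imInt hG O q z
  obtain ⟨s, hs, hsx⟩ := hσ.exists_compatible q hx
  refine ⟨s + y, ⟨s, hs, y, hy, rfl⟩, ?_⟩
  dsimp only
  rw [Matrix.mulVec_add, hsx, ← Matrix.mulVec_add, h]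

end Covering

end GraphZonotope
-- Assembly of the statement
theorem proposition3p13 {α β : Type*} [DecidableEq α] (G : Graph α β)
    [Fintype V(G)] [Fintype E(G)] (hG : IsConnected G)
    (O : RefOrientation G) (q : V(G))
    (σ : CycleSignature O) (hσ : σ.IsAcyclic) :
    -- unique decomposition of every vector
    (∀ x : E(G) → ℝ, ∃! p : (E(G) → ℝ) × (E(G) → ℝ),
      p.1 ∈ σ.extendedSection q ∧ p.2 ∈ LinearMap.ker (incMatrix O q).mulVecLin ∧
        p.1 + p.2 = x) ∧
    -- the number of rows of `D` is its rank, and `D` is a bijection from `S̃_σ` onto `ℝ^r`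
    (incMatrix O q).rank = Fintype.card {v : V(G) // v ≠ q} ∧
    Set.BijOn (fun x ↦ incMatrix O q *ᵥ x) (σ.extendedSection q) Set.univ ∧
    -- over each point of the zonotope there is exactly one compatible continuous orientation
    (∀ z ∈ zonotope (incMatrix O q), ∃! x, x ∈ σ.compatible ∧ incMatrix O q *ᵥ x = z) ∧
    -- the inverse of this bijection is a section of `D` that extends `μ`
    (∃ s : ({v : V(G) // v ≠ q} → ℝ) → (E(G) → ℝ),
      (∀ p, s p ∈ σ.extendedSection q ∧ incMatrix O q *ᵥ s p = p) ∧
      (∀ x ∈ σ.extendedSection q, s (incMatrix O q *ᵥ x) = x) ∧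
      ∀ z ∈ zonotope (incMatrix O q), s z = σ.mu q z) ∧
    -- `D` maps `S_σ` onto the zonotope
    (fun x ↦ incMatrix O q *ᵥ x) '' σ.compatible = zonotope (incMatrix O q) ∧
    -- lattice points are preserved in both directions
    (∀ x ∈ σ.extendedSection q,
      x ∈ latticePoints E(G) ↔ incMatrix O q *ᵥ x ∈ latticePoints {v : V(G) // v ≠ q}) := by
  have hbij := hσ.bijOn_extendedSection hG q
  have hinj := σ.injOn_extendedSection q
  have hsub := σ.compatible_subset_extendedSection q
  have hsec (z) : ∃ x ∈ σ.extendedSection q, incMatrix O q *ᵥ x = z :=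
    hbij.surjOn (Set.mem_univ z)
  have hfib (z) (hz : z ∈ zonotope (incMatrix O q)) :
      ∃ x ∈ σ.compatible, incMatrix O q *ᵥ x = z := by
    obtain ⟨x, hx, rfl⟩ := (mem_zonotope_iff _ _).1 hz
    exact hσ.exists_compatible q hx
  choose s hs hDs using hsec
  refine ⟨fun x ↦ ?_, rank_incMatrix hG O q, hbij, fun z hz ↦ ?_,
    ⟨s, fun p ↦ ⟨hs p, hDs p⟩, fun x hx ↦ hinj (hs _) hx (hDs _), fun z hz ↦ ?_⟩, ?_,
    fun x hx ↦ σ.mem_latticePoints_iff q hx⟩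
  · refine ⟨(s (incMatrix O q *ᵥ x), x - s (incMatrix O q *ᵥ x)), ⟨hs _, ?_, ?_⟩, ?_⟩
    · rw [LinearMap.mem_ker, Matrix.mulVecLin_apply, Matrix.mulVec_sub, hDs, sub_self]
    · exact add_sub_cancel _ _
    · rintro ⟨y, c⟩ ⟨hy, hc, rfl⟩
      rw [LinearMap.mem_ker, Matrix.mulVecLin_apply] at hc
      dsimp only at hy hc ⊢
      have : s (incMatrix O q *ᵥ (y + c)) = y := by
        refine hinj (hs _) hy ?_
        dsimp only
        rw [hDs, Matrix.mulVec_add, hc, add_zero]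
      rw [this, add_sub_cancel_left]
  · obtain ⟨x, hx, hxz⟩ := hfib z hz
    exact ⟨x, ⟨hx, hxz⟩, fun y hy ↦ hinj (hsub hy.1) (hsub hx) (hy.2.trans hxz.symm)⟩
  · have hex : ∃ x ∈ σ.compatible, (fun x ↦ incMatrix O q *ᵥ x) x = z := hfib z hz
    exact hinj (hs z) (hsub (Function.invFunOn_mem hex))
      ((hDs z).trans (Function.invFunOn_eq hex).symm)
  · ext z
    refine ⟨?_, fun hz ↦ hfib z hz⟩
    rintro ⟨x, hx, rfl⟩
    exact (mem_zonotope_iff _ _).2 ⟨x, hx.1, rfl⟩
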